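/- Let $k$ be a commutative ring, let $\mathcal C$ be a small category in which every two objects $c_1,c_2$ have a coproduct $c_1\xrightarrow{i_1}c_1\sqcup c_2\xleftarrow{i_2}c_2$ (an initial object is not required), and let $\mathcal O:\mathcal C\to\mathsf{Alg}$ be a functor to the category of (associative, unital) $k$-algebras. An $\mathcal O$-representation $\mathcal F$ is a lift of $\mathcal O$ to the category of pairs $(A,M)$ of a $k$-algebra $A$ and an $A$-module $M$, whose morphisms $(A,M)\to(B,N)$ are pairs $(\varphi,f)$ of an algebra homomorphism $\varphi:A\to B$ and a $k$-linear map $f:M\to N$ with $f(am)=\varphi(a)f(m)$. That is, $\mathcal F$ consists of an $\mathcal O(c)$-module $\mathcal F(c)$ for every object $c$, and of maps $\mathcal F(f):\mathcal F(c)\to\mathcal F(c')$, semilinear over $\mathcal O(f)$ and functorial in $f:c\to c'$. It is called additive if for every object $c$ the homomorphism of $\mathcal O(c\sqcup c)$-modules $$\bigl(\mathcal O(c\sqcup c)\otimes_{\mathcal O(c),\,\mathcal O(i_1)}\mathcal F(c)\bigr)\oplus\bigl(\mathcal O(c\sqcup c)\otimes_{\mathcal O(c),\,\mathcal O(i_2)}\mathcal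 F(c)\bigr)\longrightarrow\mathcal F(c\sqcup c),$$ whose $l$-th component is $b\otimes m\mapsto b\cdot\mathcal F(i_l)(m)$ for $l=1,2$, where $i_1,i_2:c\to c\sqcup c$ are the two coproduct inclusions, is an isomorphism. Let $\mathcal O^{\rm op}$ denote the functor $c\mapsto\mathcal O(c)^{\rm op}$. For an $\mathcal O^{\rm op}$-representation $\mathcal H$ and an $\mathcal O$-representation $\mathcal F$ let $\mathcal H\otimes_{\mathcal O}\mathcal F:\mathcal C\to\mathsf{Mod}(k)$ be the functor $c\mapsto\mathcal H(c)\otimes_{\mathcal O(c)}\mathcal F(c)$. Finally, let $\varprojlim^i$ be the $i$-th right derived functor of the left exact functor $\varprojlim:\mathsf{Mod}(k)^{\mathcal C}\to\mathsf{Mod}(k)$. **Proposition.** If $\mathcal F$ is an additive $\mathcal O$-representation and $\mathcal H$ is an $\mathcal O^{\rm op}$-representation, then $$\varprojlim{}^i\,(\mathcal H\otimes_{\mathcal O}\mathcal F)=0\qquad\text{for all } i\ge 0.$$ -/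

import Mathlib

open CategoryTheory CategoryTheory.Limits Opposite
open scoped TensorProduct

universe u

noncomputable section

namespace AlgRepresentation

/-! ### Tensor products and induced modules over noncommutative algebras -/

section Algebra

variable {k : Type u} [CommRing k]

/-- The `k`-submodule of `N ⊗[k] M` spanned by the elements `n a ⊗ m - n ⊗ a m`, for a right
`A`-module `N` (that is, a module over the opposite algebra) and a left `A`-module `M`. -/
def balancedRel (A N M : Type u) [Ring A] [Algebra k A]
    [AddCommGroup N] [Module k N] [Module Aᵐᵒᵖ N]
    [AddCommGroup M] [Module k M] [Module A M] : Submodule k (N ⊗[k] M) :=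
  Submodule.span k
    {x | ∃ (n : N) (a : A) (m : M), x = (MulOpposite.op a • n) ⊗ₜ[k] m - n ⊗ₜ[k] (a • m)}

/-- The `k`-module `N ⊗_A M` for a right module `N` and a left module `M` over a `k`-algebra `A`,
presented as the quotient of `N ⊗[k] M` by the relations `n a ⊗ m = n ⊗ a m`. -/
abbrev BalancedTensor (k : Type u) [CommRing k] (A N M : Type u) [Ring A] [Algebra k A]
    [AddCommGroup N] [Module k N] [Module Aᵐᵒᵖ N]
    [AddCommGroup M] [Module k M] [Module A M] : Type u :=
  (N ⊗[k] M) ⧸ balancedRel (k := k) A N M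

/-- Functoriality of `N ⊗_A M` along an algebra map `φ : A → B` and `φ`-semilinear maps
`g : N → N'`, `f : M → M'`: it sends `n ⊗ m` to `g n ⊗ f m`. -/
def BalancedTensor.map {A B N M N' M' : Type u} [Ring A] [Algebra k A] [Ring B] [Algebra k B]
    [AddCommGroup N] [Module k N] [Module Aᵐᵒᵖ N]
    [AddCommGroup M] [Module k M] [Module A M]
    [AddCommGroup N'] [Module k N'] [Module Bᵐᵒᵖ N']
    [AddCommGroup M'] [Module k M'] [Module B M']
    (φ : A →ₐ[k] B) (g : N →ₗ[k] N') (f : M →ₗ[k] M')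
    (hg : ∀ (a : A) (n : N), g (MulOpposite.op a • n) = MulOpposite.op (φ a) • g n)
    (hf : ∀ (a : A) (m : M), f (a • m) = φ a • f m) :
    BalancedTensor k A N M →ₗ[k] BalancedTensor k B N' M' :=
  Submodule.mapQ _ _ (TensorProduct.map g f) (by
    rw [balancedRel, Submodule.span_le]
    rintro _ ⟨n, a, m, rfl⟩
    refine Submodule.subset_span ⟨g n, φ a, f m, ?_⟩
    rw [map_sub, TensorProduct.map_tmul, TensorProduct.map_tmul, hg, hf])

variable {A B M N : Type u} [Ring A] [Algebra k A] [Ring B] [Algebra k B]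
  [AddCommGroup M] [Module k M] [Module A M]
  [AddCommGroup N] [Module k N] [Module B N] [IsScalarTower k B N]

/-- The relations `b φ(a) ⊗ m = b ⊗ a m` in `B ⊗[k] M`. They are stable under left
multiplication by `B`, so their `k`-span and their `B`-span agree. -/
def inducedRel (φ : A →ₐ[k] B) (M : Type u) [AddCommGroup M] [Module k M] [Module A M] :
    Submodule B (B ⊗[k] M) :=
  Submodule.span B {x | ∃ (b : B) (a : A) (m : M), x = (b * φ a) ⊗ₜ[k] m - b ⊗ₜ[k] (a • m)}

/-- The `B`-module `B ⊗_A M` induced from the `A`-module `M` along `φ : A → B`. -/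
abbrev Induced (φ : A →ₐ[k] B) (M : Type u) [AddCommGroup M] [Module k M] [Module A M] : Type u :=
  (B ⊗[k] M) ⧸ inducedRel φ M

/-- The `B`-linear map `B ⊗_A M → N`, `b ⊗ m ↦ b • f m`, attached to a `φ`-semilinear map
`f : M → N`. -/
def Induced.lift (φ : A →ₐ[k] B) (f : M →ₗ[k] N)
    (hf : ∀ (a : A) (m : M), f (a • m) = φ a • f m) : Induced φ M →ₗ[B] N :=
  Submodule.liftQ _
    (TensorProduct.AlgebraTensorModule.lift (LinearMap.toSpanSingleton B (M →ₗ[k] N) f)) (by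
      rw [inducedRel, Submodule.span_le]
      rintro _ ⟨b, a, m, rfl⟩
      simp [hf, mul_smul])

end Algebra

/-! ### Representations over a functor to algebras -/

section Representations

variable {C : Type u} [SmallCategory C] {k : Type u} [CommRing k]

/-- The objectwise opposite `c ↦ O(c)ᵒᵖ` of a functor `O` to `k`-algebras. -/
def opAlg (O : C ⥤ AlgCat.{u} k) : C ⥤ AlgCat.{u} k where
  obj c := AlgCat.of k (O.obj c)ᵐᵒᵖ
  map f := AlgCat.ofHom (AlgHom.op (O.map f).hom)
  map_id c := by
    ext x
    simp
  map_comp f g := by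
    ext x
    simp

/-- An `O`-representation: a lift of `O : C ⥤ Alg` to the category of pairs `(A, M)` of a
`k`-algebra and a module over it, where a morphism `(A, M) → (B, N)` consists of an algebra map
`φ : A → B` and a `k`-linear map `f : M → N` with `f (a m) = φ(a) f(m)`. Written out, it is an
`O(c)`-module for every object `c`, functorial in `c` through such semilinear maps. -/
structure Rep (O : C ⥤ AlgCat.{u} k) where
  obj : C → Type u
  [addCommGroup : ∀ c, AddCommGroup (obj c)]
  [module : ∀ c, Module k (obj c)]
  [algModule : ∀ c, Module (O.obj c) (obj c)]
  [isScalarTower : ∀ c, IsScalarTower k (O.obj c) (obj c)]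
  map : ∀ {c d : C}, (c ⟶ d) → (obj c →ₗ[k] obj d)
  map_smul : ∀ {c d : C} (f : c ⟶ d) (a : O.obj c) (m : obj c),
    map f (a • m) = (O.map f).hom a • map f m
  map_id : ∀ c : C, map (𝟙 c) = LinearMap.id
  map_comp : ∀ {c d e : C} (f : c ⟶ d) (g : d ⟶ e), map (f ≫ g) = map g ∘ₗ map f

attribute [instance] Rep.addCommGroup Rep.module Rep.algModule Rep.isScalarTower

variable {O : C ⥤ AlgCat.{u} k}

instance (H : Rep (opAlg O)) (c : C) : Module (O.obj c)ᵐᵒᵖ (H.obj c) :=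
  H.algModule c

/-- The representation `c ↦ H(c) ⊗_{O(c)} F(c)` of `C` over `k`, for an `Oᵒᵖ`-representation `H`
and an `O`-representation `F`. -/
def Rep.tensor (H : Rep (opAlg O)) (F : Rep O) : C ⥤ ModuleCat.{u} k where
  obj c := ModuleCat.of k (BalancedTensor k (O.obj c) (H.obj c) (F.obj c))
  map f := ModuleCat.ofHom (BalancedTensor.map (O.map f).hom (H.map f) (F.map f)
    (fun a n => H.map_smul f (MulOpposite.op a) n) (F.map_smul f))
  map_id c := by
    ext x
    simp [BalancedTensor.map, H.map_id, F.map_id]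
  map_comp f g := by
    ext x
    simp [BalancedTensor.map, H.map_comp, F.map_comp, TensorProduct.map_comp]

variable [HasBinaryCoproducts C]

/-- The `O(c ⊔ c)`-linear map `F(c)↑_{i₁} ⊕ F(c)↑_{i₂} → F(c ⊔ c)` whose components send
`b ⊗ m` to `b • F(i₁)(m)` and `b • F(i₂)(m)`. -/
def Rep.addMap (F : Rep O) (c : C) :
    (Induced (O.map (coprod.inl : c ⟶ c ⨿ c)).hom (F.obj c) ×
      Induced (O.map (coprod.inr : c ⟶ c ⨿ c)).hom (F.obj c)) →ₗ[O.obj (c ⨿ c)]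
      F.obj (c ⨿ c) :=
  LinearMap.coprod
    (Induced.lift _ (F.map (coprod.inl : c ⟶ c ⨿ c)) (F.map_smul _))
    (Induced.lift _ (F.map (coprod.inr : c ⟶ c ⨿ c)) (F.map_smul _))

/-- An `O`-representation is additive if all the maps `F(c)↑_{i₁} ⊕ F(c)↑_{i₂} → F(c ⊔ c)` are
isomorphisms. -/
def Rep.IsAdditive (F : Rep O) : Prop :=
  ∀ c : C, Function.Bijective (F.addMap c)

end Representations

/-! ### Higher limits -/

section HigherLimits

variable (C : Type u) [SmallCategory C] (k : Type u) [CommRing k]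

theorem isGrothendieckAbelian_presheaf :
    IsGrothendieckAbelian.{u} (Cᵒᵖ ⥤ ModuleCat.{u} k) where
  ab5OfSize := { ofShape := fun _ _ _ => inferInstance }

/-- The category of representations is a Grothendieck abelian category; in particular it has
enough injectives. -/
instance isGrothendieckAbelian_functor : IsGrothendieckAbelian.{u} (C ⥤ ModuleCat.{u} k) :=
  have := isGrothendieckAbelian_presheaf Cᵒᵖ k
  IsGrothendieckAbelian.of_equivalence
    ((opOpEquivalence C).congrLeft (E := ModuleCat.{u} k))

instance const_additive : (Functor.const C : ModuleCat.{u} k ⥤ (C ⥤ ModuleCat.{u} k)).Additive where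

instance lim_additive : (lim : (C ⥤ ModuleCat.{u} k) ⥤ ModuleCat.{u} k).Additive :=
  constLimAdj.right_adjoint_additive

/-- The higher limit functor `limⁿ`: the `n`-th right derived functor of the limit functor from
representations of `C` over `k` to `k`-modules. -/
def higherLimit (n : ℕ) : (C ⥤ ModuleCat.{u} k) ⥤ ModuleCat.{u} k :=
  (lim : (C ⥤ ModuleCat.{u} k) ⥤ ModuleCat.{u} k).rightDerived n

end HigherLimits

end AlgRepresentation

end

/-! Let `T` be precomposition with `c ↦ c ⨿ c`. The two coproduct inclusions give natural
transformations `α, β : 𝟭 ⟶ T`, and the limit functor cannot tell them apart: following either one,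
the projection of `lim X` to `X(c)` becomes the projection to `X(c ⨿ c)`. Since `T` is exact, this
persists in the derived functors: for any `r : T G ⟶ G`, the maps `α ≫ r` and `β ≫ r` induce the
same endomorphism of `limⁿ G` (`Functor.isZero_rightDerived_obj_of_retraction`). If one composite is
the identity and the other is zero, then `limⁿ G = 0`.

For `G = H ⊗ F` such an `r` comes from additivity. Project `F(c ⨿ c)` to its first summand and
contract `b ⊗ m` to `O(∇)(b) m`, where `∇` is the codiagonal; this is `p : F(c ⨿ c) → F(c)` with `p
F(i₁) = id` and `p F(i₂) = 0` (`Rep.IsAdditive.exists_contraction`). Being semilinear along `O(∇)`,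
it can be tensored with `H(∇)`, giving `r = H(∇) ⊗ p`. -/

namespace CategoryTheory

/-! ### Vanishing criterion for right derived functors. -/

section Derived

variable {A B : Type*} [Category A] [Category B] [Abelian A] [Abelian B]

/-- A morphism `r : T Z ⟶ Y`, where `T` is an exact functor, extends to a cochain map from the
image under `T` of an injective resolution of `Z` to an injective resolution of `Y`. -/
lemma InjectiveResolution.exists_map_desc (T : A ⥤ A) [T.Additive] [PreservesFiniteLimits T]
    [PreservesFiniteColimits T] {Y Z : A} (I : InjectiveResolution Y) (J : InjectiveResolution Z)
    (r : T.obj Z ⟶ Y) :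
    ∃ ρ : (T.mapHomologicalComplex _).obj J.cocomplex ⟶ I.cocomplex,
      T.map (J.ι.f 0) ≫ ρ.f 0 = r ≫ I.ι.f 0 := by
  let j : Z ⟶ J.cocomplex.X 0 := J.ι.f 0
  have hj : Mono j := inferInstanceAs (Mono (J.ι.f 0))
  -- Exactness of `T` keeps the image of `J` a resolution of `T Z`. Its terms need not be injective,
  -- since only the target `I` has to be.
  have e0 := J.exact₀.map T
  have e1 := fun n => (J.exact_succ n).map T
  let f0 : T.obj (J.cocomplex.X 0) ⟶ I.cocomplex.X 0 :=
    Injective.factorThru (r ≫ I.ι.f 0) (T.map j)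
  have hf0 : T.map j ≫ f0 = r ≫ I.ι.f 0 := Injective.comp_factorThru _ _
  let f1 : T.obj (J.cocomplex.X 1) ⟶ I.cocomplex.X 1 :=
    e0.descToInjective (f0 ≫ I.cocomplex.d 0 1) (by
      refine (Category.assoc _ _ _).symm.trans ?_
      refine (congrArg (· ≫ I.cocomplex.d 0 1) hf0).trans ?_
      refine (Category.assoc _ _ _).trans ?_
      exact (congrArg (r ≫ ·) I.ι_f_zero_comp_complex_d).trans comp_zero)
  have hf1 : T.map (J.cocomplex.d 0 1) ≫ f1 = f0 ≫ I.cocomplex.d 0 1 :=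
    e0.comp_descToInjective _ _
  refine ⟨CochainComplex.mkHom ((T.mapHomologicalComplex _).obj J.cocomplex) I.cocomplex
    f0 f1 hf1.symm fun n p => ⟨(e1 n).descToInjective (p.2.1 ≫ I.cocomplex.d _ _) ?_, ?_⟩, ?_⟩
  · refine (Category.assoc _ _ _).symm.trans ?_
    refine (congrArg (· ≫ I.cocomplex.d _ _) p.2.2.symm).trans ?_
    refine (Category.assoc _ _ _).trans ?_
    exact (congrArg (p.1 ≫ ·) (I.cocomplex.d_comp_d _ _ _)).trans comp_zero
  · exact ((e1 n).comp_descToInjective _ _).symm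
  · exact (congrArg (T.map j ≫ ·) (CochainComplex.mkHom_f_0 ..)).trans hf0

/-- Suppose that `α, β : 𝟭 ⟶ T` are natural transformations to an exact functor which become equal
after applying `L`. If some `r : T X ⟶ X` is a retraction of `α` and annihilates `β`, then all
right derived functors of `L` vanish on `X`. -/
theorem Functor.isZero_rightDerived_obj_of_retraction [HasInjectiveResolutions A]
    (L : A ⥤ B) [L.Additive] (T : A ⥤ A) [T.Additive] [PreservesFiniteLimits T]
    [PreservesFiniteColimits T] (α β : 𝟭 A ⟶ T)
    (h : ∀ X, L.map (α.app X) = L.map (β.app X)) {X : A} (r : T.obj X ⟶ X)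
    (hα : α.app X ≫ r = 𝟙 X) (hβ : β.app X ≫ r = 0) (n : ℕ) :
    IsZero ((L.rightDerived n).obj X) := by
  let I := injectiveResolution X
  obtain ⟨ρ, hρ⟩ := I.exists_map_desc T I r
  let ev (γ : 𝟭 A ⟶ T) : I.cocomplex ⟶ (T.mapHomologicalComplex _).obj I.cocomplex :=
    { f := fun j => γ.app (I.cocomplex.X j)
      comm' := fun i j _ => (γ.naturality (I.cocomplex.d i j)).symm }
  -- For either transformation, `ev γ ≫ ρ` lifts `γ.app X ≫ r` to the resolution, so it computes the
  -- derived map of that endomorphism.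
  have key (γ : 𝟭 A ⟶ T) :
      I.ι ≫ ev γ ≫ ρ = (CochainComplex.single₀ A).map (γ.app X ≫ r) ≫ I.ι := by
    ext
    have h1 : I.ι.f 0 ≫ γ.app (I.cocomplex.X 0) = γ.app X ≫ T.map (I.ι.f 0) :=
      γ.naturality (I.ι.f 0)
    change I.ι.f 0 ≫ γ.app (I.cocomplex.X 0) ≫ ρ.f 0 = _
    refine (Category.assoc _ _ _).symm.trans ?_
    refine (congrArg (· ≫ ρ.f 0) h1).trans ?_
    refine (Category.assoc _ _ _).trans ?_
    refine (congrArg (γ.app X ≫ ·) hρ).trans ?_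
    simp
  have hL : (L.mapHomologicalComplex (ComplexShape.up ℕ)).map (ev α ≫ ρ) =
      (L.mapHomologicalComplex _).map (ev β ≫ ρ) := by
    ext j
    change L.map (α.app (I.cocomplex.X j) ≫ ρ.f j) = L.map (β.app (I.cocomplex.X j) ≫ ρ.f j)
    refine (L.map_comp _ _).trans (Eq.trans ?_ (L.map_comp _ _).symm)
    exact congrArg (· ≫ L.map (ρ.f j)) (h _)
  have e : (L.rightDerived n).map (α.app X ≫ r) = (L.rightDerived n).map (β.app X ≫ r) := by
    rw [L.rightDerived_map_eq n _ _ (key α), L.rightDerived_map_eq n _ _ (key β)]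
    simp only [Functor.comp_map, hL]
  have e0 : (L.rightDerived n).map (0 : X ⟶ X) = 0 := by
    rw [L.rightDerived_map_eq n (P := I) (Q := I) _ 0 (by simp), Functor.map_zero,
      zero_comp, comp_zero]
  rw [IsZero.iff_id_eq_zero, ← Functor.map_id, ← hα, e, hβ, e0]

end Derived

/-! ### The doubling functor and vanishing of higher limits. -/

section Coproducts

variable {C : Type*} [Category C] [HasBinaryCoproducts C]

variable (C) in
/-- The functor `c ↦ c ⨿ c`. -/
noncomputable def doubling : C ⥤ C where
  obj c := c ⨿ c
  map f := coprod.map f f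

/-- The first coproduct inclusion, as a natural transformation. -/
noncomputable def doublingInl : 𝟭 C ⟶ doubling C where
  app _ := coprod.inl
  naturality _ _ f := (coprod.inl_map f f).symm

/-- The second coproduct inclusion, as a natural transformation. -/
noncomputable def doublingInr : 𝟭 C ⟶ doubling C where
  app _ := coprod.inr
  naturality _ _ f := (coprod.inr_map f f).symm

end Coproducts

end CategoryTheory

namespace AlgRepresentation

variable {k : Type u} [CommRing k] {C : Type u} [SmallCategory C] [HasBinaryCoproducts C]

/-- If the two maps `G(c) ⟶ G(c ⨿ c)` admit a natural common map `r` back to `G(c)` which is a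
retraction of the first and annihilates the second, then the higher limits of `G` vanish. -/
theorem isZero_higherLimit_of_retraction (G : C ⥤ ModuleCat.{u} k) (r : doubling C ⋙ G ⟶ G)
    (hl : ∀ c, G.map (coprod.inl : c ⟶ c ⨿ c) ≫ r.app c = 𝟙 _)
    (hr : ∀ c, G.map (coprod.inr : c ⟶ c ⨿ c) ≫ r.app c = 0) (i : ℕ) :
    IsZero ((higherLimit C k i).obj G) := by
  let T := (Functor.whiskeringLeft C C (ModuleCat.{u} k)).obj (doubling C)
  have : T.Additive := {}
  let α (γ : 𝟭 C ⟶ doubling C) : 𝟭 (C ⥤ ModuleCat.{u} k) ⟶ T :=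
    { app := fun G => Functor.whiskerRight γ G }
  refine Functor.isZero_rightDerived_obj_of_retraction (A := C ⥤ ModuleCat.{u} k) lim T
    (α doublingInl) (α doublingInr) (fun X => ?_) r ?_ ?_ i
  -- Both composites equal the limit projection at `c ⨿ c`.
  · refine limit.hom_ext fun c => ?_
    refine (limMap_π _ c).trans (Eq.trans ?_ (limMap_π _ c).symm)
    exact
      (limit.w X (coprod.inl : c ⟶ c ⨿ c)).trans (limit.w X (coprod.inr : c ⟶ c ⨿ c)).symm
  · ext1
    ext1 c
    exact hl c
  · ext1
    ext1 c
    exact hr c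

end AlgRepresentation
namespace AlgRepresentation

/-! ### Generators and contractions of induced modules. -/

section Algebra

variable {k : Type u} [CommRing k] {A B M N : Type u} [Ring A] [Algebra k A] [Ring B] [Algebra k B]
  [AddCommGroup M] [Module k M] [Module A M]
  [AddCommGroup N] [Module k N] [Module B N]

@[simp]
lemma Induced.lift_mk_tmul [IsScalarTower k B N] (φ : A →ₐ[k] B) (f : M →ₗ[k] N)
    (hf : ∀ (a : A) (m : M), f (a • m) = φ a • f m) (b : B) (m : M) :
    Induced.lift φ f hf (Submodule.Quotient.mk (b ⊗ₜ[k] m)) = b • f m := by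
  simp [Induced.lift]

section

variable {M' N' : Type u} [AddCommGroup M'] [Module k M'] [Module Aᵐᵒᵖ M']
  [AddCommGroup N'] [Module k N'] [Module Bᵐᵒᵖ N']

lemma BalancedTensor.hom_ext {P : Type u} [AddCommGroup P] [Module k P]
    {f g : BalancedTensor k A M' M →ₗ[k] P}
    (h : ∀ n m, f (Submodule.Quotient.mk (n ⊗ₜ m)) = g (Submodule.Quotient.mk (n ⊗ₜ m))) :
    f = g :=
  Submodule.linearMap_qext _ (TensorProduct.ext' h)

@[simp]
lemma BalancedTensor.map_mk_tmul (φ : A →ₐ[k] B) (g : M' →ₗ[k] N') (f : M →ₗ[k] N)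
    (hg : ∀ (a : A) (n : M'), g (MulOpposite.op a • n) = MulOpposite.op (φ a) • g n)
    (hf : ∀ (a : A) (m : M), f (a • m) = φ a • f m) (n : M') (m : M) :
    BalancedTensor.map φ g f hg hf (Submodule.Quotient.mk (n ⊗ₜ[k] m)) =
      Submodule.Quotient.mk (g n ⊗ₜ[k] f m) := by
  simp [BalancedTensor.map]

end

lemma Induced.induction {φ : A →ₐ[k] B} {p : Induced φ M → Prop} (x : Induced φ M)
    (tmul : ∀ b m, p (Submodule.Quotient.mk (b ⊗ₜ[k] m)))
    (add : ∀ x y, p x → p y → p (x + y)) : p x := by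
  obtain ⟨x, rfl⟩ := Submodule.Quotient.mk_surjective _ x
  induction x with
  | zero => simpa using tmul 0 0
  | tmul b m => exact tmul b m
  | add x y hx hy => exact add _ _ hx hy

/-- If `ψ : B → A` is a retraction of `φ : A → B`, then there is a `ψ`-semilinear map
`B ⊗_A M → M` sending `b ⊗ m` to `ψ(b) m`. -/
lemma Induced.exists_contraction [IsScalarTower k A M] (φ : A →ₐ[k] B) (ψ : B →ₐ[k] A)
    (h : ∀ a, ψ (φ a) = a) :
    ∃ q : Induced φ M →ₗ[k] M,
      (∀ (b : B) (x : Induced φ M), q (b • x) = ψ b • q x) ∧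
      ∀ (b : B) (m : M), q (Submodule.Quotient.mk (b ⊗ₜ[k] m)) = ψ b • m := by
  -- Restricting scalars along `ψ` makes `M` a `B`-module. The identity of `M` is then
  -- `φ`-semilinear, exactly because `ψ` retracts `φ`, and the contraction is its lift.
  let : Module B M := Module.compHom M (ψ : B →+* A)
  have : IsScalarTower k B M := ⟨fun r b m => by
    change ψ (r • b) • m = r • ψ b • m
    rw [map_smul, smul_assoc]⟩
  have hid (a : A) (m : M) : (LinearMap.id : M →ₗ[k] M) (a • m) =
      φ a • (LinearMap.id : M →ₗ[k] M) m := by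
    change a • m = ψ (φ a) • m
    rw [h]
  let q := Induced.lift φ (LinearMap.id : M →ₗ[k] M) hid
  have hq (b : B) (x : Induced φ M) : q (b • x) = ψ b • q x := q.map_smul b x
  refine ⟨{ toFun := q, map_add' := q.map_add, map_smul' := fun r x => ?_ }, hq, fun b m => ?_⟩
  · rw [← algebraMap_smul B r x, hq]
    simp
  · exact Induced.lift_mk_tmul φ _ hid b m

end Algebra

/-! ### The contraction of an additive representation and its tensor product. -/

section Representations

variable {k : Type u} [CommRing k] {C : Type u} [SmallCategory C] {O : C ⥤ AlgCat.{u} k}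

lemma Rep.map_map (F : Rep O) {c d e : C} (f : c ⟶ d) (g : d ⟶ e) (m : F.obj c) :
    F.map g (F.map f m) = F.map (f ≫ g) m := by
  rw [F.map_comp, LinearMap.comp_apply]

lemma Rep.tensor_map_mk_tmul (H : Rep (opAlg O)) (F : Rep O) {c d : C} (f : c ⟶ d)
    (n : H.obj c) (m : F.obj c) :
    ((H.tensor F).map f).hom (Submodule.Quotient.mk (n ⊗ₜ[k] m)) =
      Submodule.Quotient.mk (H.map f n ⊗ₜ[k] F.map f m) :=
  BalancedTensor.map_mk_tmul (O.map f).hom (H.map f) (F.map f)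
    (fun a n => H.map_smul f (MulOpposite.op a) n) (F.map_smul f) n m

lemma Rep.tensor_hom_ext {H : Rep (opAlg O)} {F : Rep O} {c : C} {P : ModuleCat.{u} k}
    {f g : (H.tensor F).obj c ⟶ P}
    (h : ∀ (n : H.obj c) (m : F.obj c),
      f.hom (Submodule.Quotient.mk (n ⊗ₜ[k] m)) = g.hom (Submodule.Quotient.mk (n ⊗ₜ[k] m))) :
    f = g :=
  ModuleCat.hom_ext (BalancedTensor.hom_ext h)

variable [HasBinaryCoproducts C]

lemma Rep.addMap_mk_tmul (F : Rep O) (c : C) (b b' : O.obj (c ⨿ c)) (m m' : F.obj c) :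
    F.addMap c (Submodule.Quotient.mk (b ⊗ₜ[k] m), Submodule.Quotient.mk (b' ⊗ₜ[k] m')) =
      b • F.map coprod.inl m + b' • F.map coprod.inr m' := by
  rw [Rep.addMap, LinearMap.coprod_apply, Induced.lift_mk_tmul, Induced.lift_mk_tmul]

/-- For an additive representation, `F(c ⨿ c)` is generated by the images of the two inclusions. -/
lemma Rep.IsAdditive.induction {F : Rep O} (hF : F.IsAdditive) {c : C}
    {p : F.obj (c ⨿ c) → Prop} (x : F.obj (c ⨿ c))
    (inl : ∀ (b : O.obj (c ⨿ c)) (m : F.obj c), p (b • F.map coprod.inl m))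
    (inr : ∀ (b : O.obj (c ⨿ c)) (m : F.obj c), p (b • F.map coprod.inr m))
    (add : ∀ x y, p x → p y → p (x + y)) : p x := by
  obtain ⟨⟨y, z⟩, rfl⟩ := (hF c).2 x
  have : ((y, z) : _ × _) = (y, 0) + (0, z) := by simp
  rw [this, map_add]
  refine add _ _ ?_ ?_
  · induction y using Induced.induction with
    | tmul b m =>
      have := F.addMap_mk_tmul c b 0 m 0
      simp only [TensorProduct.zero_tmul, Submodule.Quotient.mk_zero, zero_smul, add_zero] at this
      rw [this]
      exact inl b m
    | add x y hx hy =>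
      have : ((x + y, 0) : _ × Induced (O.map (coprod.inr : c ⟶ c ⨿ c)).hom (F.obj c)) =
        (x, 0) + (y, 0) := by simp
      rw [this, map_add]
      exact add _ _ (hx (by simp)) (hy (by simp))
  · induction z using Induced.induction with
    | tmul b m =>
      have := F.addMap_mk_tmul c 0 b 0 m
      simp only [TensorProduct.zero_tmul, Submodule.Quotient.mk_zero, zero_smul, zero_add] at this
      rw [this]
      exact inr b m
    | add x y hx hy =>
      have : ((0, x + y) : Induced (O.map (coprod.inl : c ⟶ c ⨿ c)).hom (F.obj c) × _) =
        (0, x) + (0, y) := by simp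
      rw [this, map_add]
      exact add _ _ (hx (by simp)) (hy (by simp))

/-- For an additive representation `F`, there is a map `F(c ⨿ c) → F(c)`, semilinear along the
codiagonal, which is a retraction of `F(i₁)` and annihilates `F(i₂)`. -/
lemma Rep.IsAdditive.exists_contraction {F : Rep O} (hF : F.IsAdditive) (c : C) :
    ∃ p : F.obj (c ⨿ c) →ₗ[k] F.obj c,
      (∀ (b : O.obj (c ⨿ c)) (x : F.obj (c ⨿ c)),
        p (b • x) = (O.map (codiag c)).hom b • p x) ∧
      (∀ m, p (F.map coprod.inl m) = m) ∧ ∀ m, p (F.map coprod.inr m) = 0 := by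
  -- `O(∇)` retracts `O(i₁)` because `i₁ ≫ ∇ = 𝟙`. The desired map is `q` after the first projection
  -- and the inverse of `F.addMap c`.
  obtain ⟨q, hq, hq'⟩ := Induced.exists_contraction (M := F.obj c)
    (O.map (coprod.inl : c ⟶ c ⨿ c)).hom (O.map (codiag c)).hom (fun a => by
      rw [← AlgCat.comp_apply, ← O.map_comp, coprod.inl_desc, O.map_id, AlgCat.id_apply])
  let e := LinearEquiv.ofBijective (F.addMap c) (hF c)
  have he (r : k) (x : F.obj (c ⨿ c)) : e.symm (r • x) = r • e.symm x := by
    rw [← algebraMap_smul (O.obj (c ⨿ c)) r x, LinearEquiv.map_smul, algebraMap_smul]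
  refine ⟨{ toFun x := q (e.symm x).1, map_add' x y := by simp, map_smul' r x := by simp [he] },
    fun b x => ?_, fun m => ?_, fun m => ?_⟩
  · change q (e.symm (b • x)).1 = _ • q (e.symm x).1
    rw [LinearEquiv.map_smul, Prod.smul_fst, hq]
  · change q (e.symm _).1 = _
    have := F.addMap_mk_tmul c 1 0 m 0
    simp only [one_smul, zero_smul, add_zero] at this
    rw [← this, ← LinearEquiv.ofBijective_apply (F.addMap c) (hf := hF c), e.symm_apply_apply, hq']
    simp
  · change q (e.symm _).1 = _
    have := F.addMap_mk_tmul c 0 1 0 m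
    simp only [one_smul, zero_smul, zero_add] at this
    rw [← this, ← LinearEquiv.ofBijective_apply (F.addMap c) (hf := hF c), e.symm_apply_apply, hq']
    simp

/-- The map `F(c ⨿ c) → F(c)` sending `b • F(i₁)(m)` to `O(∇)(b) • m` and `b • F(i₂)(m)` to `0`. -/
noncomputable def Rep.IsAdditive.contraction {F : Rep O} (hF : F.IsAdditive) (c : C) :
    F.obj (c ⨿ c) →ₗ[k] F.obj c :=
  (hF.exists_contraction c).choose

section

variable {F : Rep O} (hF : F.IsAdditive)

lemma Rep.IsAdditive.contraction_smul (c : C) (b : O.obj (c ⨿ c)) (x : F.obj (c ⨿ c)) :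
    hF.contraction c (b • x) = (O.map (codiag c)).hom b • hF.contraction c x :=
  (hF.exists_contraction c).choose_spec.1 b x

lemma Rep.IsAdditive.contraction_inl (c : C) (m : F.obj c) :
    hF.contraction c (F.map coprod.inl m) = m :=
  (hF.exists_contraction c).choose_spec.2.1 m

lemma Rep.IsAdditive.contraction_inr (c : C) (m : F.obj c) :
    hF.contraction c (F.map coprod.inr m) = 0 :=
  (hF.exists_contraction c).choose_spec.2.2 m

/-- Although chosen separately for each object, the contraction is determined by its semilinearity
and its values on the two inclusions, as these generate `F(c ⨿ c)`. Naturality therefore reduces to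
that of the inclusions and of the codiagonal. -/
lemma Rep.IsAdditive.contraction_naturality {c d : C} (f : c ⟶ d) (x : F.obj (c ⨿ c)) :
    hF.contraction d (F.map (coprod.map f f) x) = F.map f (hF.contraction c x) := by
  have hO (b : O.obj (c ⨿ c)) : (O.map (codiag d)).hom ((O.map (coprod.map f f)).hom b) =
      (O.map f).hom ((O.map (codiag c)).hom b) := by
    rw [← AlgCat.comp_apply, ← AlgCat.comp_apply, ← O.map_comp, ← O.map_comp, coprod.map_codiag]
  induction x using Rep.IsAdditive.induction hF with
  | inl b m =>
    rw [F.map_smul, hF.contraction_smul, F.map_map, coprod.inl_map, ← F.map_map,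
      hF.contraction_inl, hF.contraction_smul, hF.contraction_inl, F.map_smul, hO]
  | inr b m =>
    rw [F.map_smul, hF.contraction_smul, F.map_map, coprod.inr_map, ← F.map_map,
      hF.contraction_inr, hF.contraction_smul, hF.contraction_inr, smul_zero, smul_zero, map_zero]
  | add x y hx hy => simp only [map_add, hx, hy]

/-- For an additive representation `F`, the map `n ⊗ x ↦ H(∇)(n) ⊗ p(x)` from
`H(c ⨿ c) ⊗ F(c ⨿ c)` to `H(c) ⊗ F(c)`, where `p` is the contraction of `F`. -/
noncomputable def Rep.IsAdditive.tensorContractionApp (H : Rep (opAlg O)) (c : C) :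
    (H.tensor F).obj (c ⨿ c) ⟶ (H.tensor F).obj c :=
  ModuleCat.ofHom (BalancedTensor.map (O.map (codiag c)).hom (H.map (codiag c))
    (hF.contraction c) (fun a n => H.map_smul (codiag c) (MulOpposite.op a) n)
    (hF.contraction_smul c))

lemma Rep.IsAdditive.tensorContractionApp_mk_tmul (H : Rep (opAlg O)) (c : C)
    (n : H.obj (c ⨿ c)) (x : F.obj (c ⨿ c)) :
    (hF.tensorContractionApp H c).hom (Submodule.Quotient.mk (n ⊗ₜ[k] x)) =
      Submodule.Quotient.mk (H.map (codiag c) n ⊗ₜ[k] hF.contraction c x) :=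
  BalancedTensor.map_mk_tmul (O.map (codiag c)).hom (H.map (codiag c)) (hF.contraction c)
    (fun a n => H.map_smul (codiag c) (MulOpposite.op a) n) (hF.contraction_smul c) n x

/-- The maps `tensorContractionApp` as a natural transformation. -/
noncomputable def Rep.IsAdditive.tensorContraction (H : Rep (opAlg O)) :
    doubling C ⋙ H.tensor F ⟶ H.tensor F where
  app c := hF.tensorContractionApp H c
  naturality c d f := by
    have hH (n : H.obj (c ⨿ c)) : H.map (codiag d) (H.map (coprod.map f f) n) =
        H.map f (H.map (codiag c) n) := by
      rw [H.map_map, H.map_map, coprod.map_codiag]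
    change (H.tensor F).map (coprod.map f f) ≫ _ = _
    refine Rep.tensor_hom_ext fun n x => ?_
    refine (congrArg (hF.tensorContractionApp H d).hom (H.tensor_map_mk_tmul F _ n x)).trans ?_
    refine Eq.trans ?_ (congrArg ((H.tensor F).map f).hom
      (hF.tensorContractionApp_mk_tmul H c n x)).symm
    rw [hF.tensorContractionApp_mk_tmul, Rep.tensor_map_mk_tmul, hH, hF.contraction_naturality]

end

end Representations

end AlgRepresentation

theorem mainTheorem9 {k : Type u} [CommRing k] {C : Type u} [SmallCategory C]
    [HasBinaryCoproducts C] (O : C ⥤ AlgCat.{u} k)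
    (F : AlgRepresentation.Rep O) (hF : F.IsAdditive)
    (H : AlgRepresentation.Rep (AlgRepresentation.opAlg O)) (i : ℕ) :
    IsZero ((AlgRepresentation.higherLimit C k i).obj (H.tensor F)) := by
  -- Needed for the first inclusion only; for the second, the `F`-factor already vanishes.
  have hH (c : C) (n : H.obj c) : H.map (codiag c) (H.map coprod.inl n) = n := by
    rw [H.map_map, coprod.inl_desc, H.map_id, LinearMap.id_apply]
  refine AlgRepresentation.isZero_higherLimit_of_retraction _ (hF.tensorContraction H)
    (fun c => AlgRepresentation.Rep.tensor_hom_ext fun n x => ?_)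
    (fun c => AlgRepresentation.Rep.tensor_hom_ext fun n x => ?_) i
  · refine (congrArg (hF.tensorContractionApp H c).hom (H.tensor_map_mk_tmul F _ n x)).trans ?_
    rw [hF.tensorContractionApp_mk_tmul, hH, hF.contraction_inl]
    rfl
  · refine (congrArg (hF.tensorContractionApp H c).hom (H.tensor_map_mk_tmul F _ n x)).trans ?_
    rw [hF.tensorContractionApp_mk_tmul, hF.contraction_inr, TensorProduct.tmul_zero]
    rfl
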